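/- Let $G$ be a compact (Hausdorff) topological group with Haar probability measure $dg$, and let $D>0$. Suppose that $G$ is $D$-quasi-random, that is, every continuous finite-dimensional complex representation of $G$ of dimension less than $D$ is trivial. Let $\pi$ be a (strongly continuous) unitary representation of $G$ on a complex Hilbert space $V$, let $V^\circ=\{w\in V:\ \pi^g w=w \text{ for all } g\in G\}$, and let $P^\circ:V\to V^\circ$ be the orthogonal projection. Then for all $u,v\in V$ the function $g\mapsto|\langle u,\pi^g v\rangle-\langle P^\circ u,P^\circ v\rangle|^2$ is integrable on $G$, and $$\int_G\big|\langle u,\pi^g v\rangle-\langle P^\circ u,P^\circ v\rangle\big|^2\,dg\ \le\ D^{-1/2}\,\|u\|^2\|v\|^2 .$$ Moreover, the bound improves to $$\int_G\big|\langle u,\pi^g v\rangle-\langle P^\circ u,P^\circ v\rangle\big|^2\,dg\ \le\ D^{-1}\,\|u\|^2\|v\|^2 .$$ -/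

import Mathlib

open MeasureTheory

/-- A topological group `G` is `D`-quasi-random if every continuous finite-dimensional complex
representation of `G` of dimension less than `D` is trivial. -/
def IsQuasiRandom (G : Type*) [Group G] [TopologicalSpace G] (D : ℝ) : Prop :=
  ∀ n : ℕ, (n : ℝ) < D →
    ∀ ρ : G →* Matrix.GeneralLinearGroup (Fin n) ℂ, Continuous ρ → ∀ g : G, ρ g = 1

/-- A (strongly continuous) unitary representation of a topological group `G` on a complex inner
product space `V`: a homomorphism to the group of surjective linear isometries of `V` such that
`g ↦ π g v` is continuous for every `v`. -/
structure UnitaryRep (G : Type*) [Group G] [TopologicalSpace G]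
    (V : Type*) [NormedAddCommGroup V] [InnerProductSpace ℂ V] where
  /-- The underlying group homomorphism. -/
  toHom : G →* (V ≃ₗᵢ[ℂ] V)
  /-- Strong continuity. -/
  continuous_apply : ∀ v : V, Continuous fun g : G => toHom g v

namespace UnitaryRep

/-- The trivial component of `π`: the subspace of vectors fixed by every `π g`. -/
def fixed {G : Type*} [Group G] [TopologicalSpace G] {V : Type*} [NormedAddCommGroup V]
    [InnerProductSpace ℂ V] (π : UnitaryRep G V) : Submodule ℂ V where
  carrier := {v | ∀ g : G, π.toHom g v = v}
  zero_mem' := by simp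
  add_mem' := by
    intro a b ha hb g
    rw [map_add, ha g, hb g]
  smul_mem' := by
    intro c v hv g
    rw [map_smul, hv g]

theorem isClosed_fixed {G : Type*} [Group G] [TopologicalSpace G] {V : Type*}
    [NormedAddCommGroup V] [InnerProductSpace ℂ V] (π : UnitaryRep G V) :
    IsClosed (π.fixed : Set V) := by
  have h : (π.fixed : Set V) = ⋂ g : G, {v : V | π.toHom g v = v} := by
    ext v
    simp [fixed]
  rw [h]
  exact isClosed_iInter fun g => isClosed_eq (π.toHom g).continuous continuous_id

instance completeSpace_fixed {G : Type*} [Group G] [TopologicalSpace G] {V : Type*}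
    [NormedAddCommGroup V] [InnerProductSpace ℂ V] [CompleteSpace V] (π : UnitaryRep G V) :
    CompleteSpace π.fixed :=
  π.isClosed_fixed.completeSpace_coe

/-- The orthogonal projection of the Hilbert space `V` onto the trivial component of `π`. -/
noncomputable def proj {G : Type*} [Group G] [TopologicalSpace G] {V : Type*}
    [NormedAddCommGroup V] [InnerProductSpace ℂ V] [CompleteSpace V] (π : UnitaryRep G V) :
    V →L[ℂ] V :=
  π.fixed.starProjection

end UnitaryRep

open InnerProductSpace

/-! Removing the fixed components reduces everything to `u`, `v` orthogonal to `π.fixed`. The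
integral is then `⟪u, T u⟫`, where `T` averages the rank one operators of the orbit of `v`. This `T`
is positive, compact and commutes with `G`, and its trace is at most `‖v‖ ^ 2`. If `T ≠ 0`, then
`‖T‖` is an eigenvalue with a finite-dimensional invariant eigenspace. `T` kills fixed vectors, so
that eigenspace is not trivial as a representation and has dimension at least `D`. The trace bound
gives `D * ‖T‖ ≤ ‖v‖ ^ 2`, hence the bound with `D⁻¹`. -/

/-- Every positive compact operator on a Hilbert space has its norm as an eigenvalue,
unless it vanishes. -/
theorem IsCompactOperator.hasEigenvalue_norm_of_isPositive {V : Type*} [NormedAddCommGroup V]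
    [InnerProductSpace ℂ V] [CompleteSpace V] {T : V →L[ℂ] V} (hT : IsCompactOperator T)
    (hpos : T.IsPositive) (h0 : T ≠ 0) :
    Module.End.HasEigenvalue (T : Module.End ℂ V) (‖T‖ : ℂ) := by
  have : Nontrivial (V →L[ℂ] V) := ⟨T, 0, h0⟩
  have hmem : ‖T‖ ∈ spectrum ℝ T :=
    CStarAlgebra.norm_mem_spectrum_of_nonneg ((T.nonneg_iff_isPositive).2 hpos)
  refine (hT.hasEigenvalue_iff_mem_spectrum ?_).2 (spectrum.algebraMap_mem ℂ hmem)
  simpa using h0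

theorem isCompactOperator_rankOne {V : Type*} [NormedAddCommGroup V] [InnerProductSpace ℂ V]
    (x y : V) : IsCompactOperator (rankOne ℂ x y) :=
  (isCompactOperator_of_locallyCompactSpace_dom (innerSL ℂ y)).clm_comp
    (ContinuousLinearMap.toSpanSingleton ℂ x)

theorem Continuous.integrable_of_compactSpace {X E : Type*} [TopologicalSpace X] [CompactSpace X]
    [MeasurableSpace X] [OpensMeasurableSpace X] {μ : Measure X} [IsFiniteMeasure μ]
    [NormedAddCommGroup E] {f : X → E} (hf : Continuous f) : Integrable f μ :=
  hf.integrable_of_hasCompactSupport (HasCompactSupport.of_compactSpace f)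

namespace UnitaryRep

section Algebraic

variable {G : Type*} [Group G] [TopologicalSpace G] {V : Type*} [NormedAddCommGroup V]
  [InnerProductSpace ℂ V] (π : UnitaryRep G V)

theorem mem_fixed {v : V} : v ∈ π.fixed ↔ ∀ g : G, π.toHom g v = v := Iff.rfl

theorem toHom_mul_apply (g h : G) (v : V) : π.toHom (g * h) v = π.toHom g (π.toHom h v) := by
  rw [map_mul]
  rfl

theorem inner_apply_left (g : G) (x y : V) :
    inner ℂ (π.toHom g x) y = inner ℂ x (π.toHom g⁻¹ y) := by
  rw [← (π.toHom g⁻¹).inner_map_map, ← toHom_mul_apply]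
  simp

theorem inner_apply_right_of_mem_fixed {w : V} (hw : w ∈ π.fixed) (g : G) (v : V) :
    inner ℂ w (π.toHom g v) = inner ℂ w v := by
  conv_lhs => rw [← π.mem_fixed.1 hw g]
  exact (π.toHom g).inner_map_map w v

/-- The matrix representation of `G` on a finite-dimensional invariant subspace. -/
noncomputable def matrixRep {ι : Type*} [Fintype ι] [DecidableEq ι] {W : Submodule ℂ V}
    (b : OrthonormalBasis ι ℂ W) (hW : ∀ g, ∀ w ∈ W, π.toHom g w ∈ W) :
    G →* Matrix ι ι ℂ where
  toFun g := LinearMap.toMatrix b.toBasis b.toBasis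
    ((π.toHom g).toLinearEquiv.toLinearMap.restrict (hW g))
  map_one' := by
    rw [← LinearMap.toMatrix_one b.toBasis]
    congr 1
    ext w
    simp
  map_mul' g h := by
    rw [← LinearMap.toMatrix_mul]
    congr 1
    ext w
    simp

theorem matrixRep_apply {ι : Type*} [Fintype ι] [DecidableEq ι] {W : Submodule ℂ V}
    (b : OrthonormalBasis ι ℂ W) (hW : ∀ g, ∀ w ∈ W, π.toHom g w ∈ W) (g : G) (i j : ι) :
    π.matrixRep b hW g i j = inner ℂ (b i : V) (π.toHom g (b j)) := by
  simp [matrixRep, LinearMap.toMatrix_apply, OrthonormalBasis.repr_apply_apply,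
    Submodule.coe_inner]

theorem continuous_matrixRep {ι : Type*} [Fintype ι] [DecidableEq ι] {W : Submodule ℂ V}
    (b : OrthonormalBasis ι ℂ W) (hW : ∀ g, ∀ w ∈ W, π.toHom g w ∈ W) :
    Continuous (π.matrixRep b hW) := by
  refine continuous_matrix fun i j => ?_
  simp only [matrixRep_apply]
  exact continuous_const.inner (π.continuous_apply _)

theorem le_fixed_of_matrixRep_eq_one {ι : Type*} [Fintype ι] [DecidableEq ι] {W : Submodule ℂ V}
    (b : OrthonormalBasis ι ℂ W) (hW : ∀ g, ∀ w ∈ W, π.toHom g w ∈ W)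
    (h : ∀ g, π.matrixRep b hW g = 1) : W ≤ π.fixed := by
  intro w hw g
  have h1 := h g
  rw [← LinearMap.toMatrix_one b.toBasis] at h1
  have h2 := LinearMap.congr_fun ((LinearMap.toMatrix b.toBasis b.toBasis).injective h1) ⟨w, hw⟩
  simpa using congrArg Subtype.val h2

/-- An invariant subspace of dimension less than `D` is fixed if `G` is `D`-quasi-random. -/
theorem le_fixed_of_finrank_lt [IsTopologicalGroup G] {D : ℝ} (hG : IsQuasiRandom G D)
    {W : Submodule ℂ V} [FiniteDimensional ℂ W] (hW : ∀ g, ∀ w ∈ W, π.toHom g w ∈ W)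
    (hdim : (Module.finrank ℂ W : ℝ) < D) : W ≤ π.fixed := by
  let b := stdOrthonormalBasis ℂ W
  refine π.le_fixed_of_matrixRep_eq_one b hW fun g => ?_
  -- The topology on units also requires continuity of the inverse, which is the matrix of `g⁻¹`.
  have hcont : Continuous (π.matrixRep b hW).toHomUnits := by
    refine Units.continuous_iff.2 ⟨π.continuous_matrixRep b hW, ?_⟩
    have : (fun g => (((π.matrixRep b hW).toHomUnits g)⁻¹ : (Matrix _ _ ℂ)ˣ).val) =
        fun g => π.matrixRep b hW g⁻¹ := by
      ext1 g
      rw [← map_inv, MonoidHom.coe_toHomUnits]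
    rw [this]
    exact (π.continuous_matrixRep b hW).comp continuous_inv
  have h := congrArg Units.val (hG _ hdim _ hcont g)
  simpa using h

/-- Strong continuity of `π` already gives continuity in operator norm here, so the average exists
as a Bochner integral of operators. -/
theorem continuous_rankOne_apply (v : V) :
    Continuous fun g => rankOne ℂ (π.toHom g v) (π.toHom g v) := by
  have hc := π.continuous_apply v
  simp only [rankOne_def]
  fun_prop

end Algebraic

section Average

variable {G : Type*} [Group G] [TopologicalSpace G] [CompactSpace G] [MeasurableSpace G]
  [BorelSpace G] (μ : Measure G) [IsProbabilityMeasure μ]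
  {V : Type*} [NormedAddCommGroup V] [InnerProductSpace ℂ V]
  (π : UnitaryRep G V)

/-- The average over `G` of the rank one operators `x ↦ ⟪π g v, x⟫ π g v`. -/
noncomputable def orbitOperator (v : V) : V →L[ℂ] V :=
  ∫ g, rankOne ℂ (π.toHom g v) (π.toHom g v) ∂μ

theorem orbitOperator_apply (v x : V) :
    π.orbitOperator μ v x = ∫ g, inner ℂ (π.toHom g v) x • π.toHom g v ∂μ := by
  rw [orbitOperator, ContinuousLinearMap.integral_apply
    (π.continuous_rankOne_apply v).integrable_of_compactSpace]
  rfl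

theorem inner_orbitOperator [CompleteSpace V] (v x y : V) :
    inner ℂ x (π.orbitOperator μ v y) =
      ∫ g, inner ℂ (π.toHom g v) y * inner ℂ x (π.toHom g v) ∂μ := by
  have hc := π.continuous_apply v
  have hint : Integrable (fun g => (inner ℂ (π.toHom g v) y : ℂ) • π.toHom g v) μ :=
    ((hc.inner continuous_const).smul hc).integrable_of_compactSpace
  rw [orbitOperator_apply, ← integral_inner hint]
  simp only [inner_smul_right]

theorem inner_orbitOperator_self [CompleteSpace V] (v x : V) :
    inner ℂ x (π.orbitOperator μ v x) =
      ((∫ g, ‖inner ℂ x (π.toHom g v)‖ ^ 2 ∂μ : ℝ) : ℂ) := by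
  rw [inner_orbitOperator, ← integral_complex_ofReal]
  congr 1
  ext g
  rw [← inner_conj_symm, mul_comm, Complex.mul_conj, Complex.normSq_eq_norm_sq]

theorem isPositive_orbitOperator [CompleteSpace V] (v : V) : (π.orbitOperator μ v).IsPositive := by
  refine ⟨fun x y => ?_, fun x => ?_⟩
  · change inner ℂ (π.orbitOperator μ v x) y = inner ℂ x (π.orbitOperator μ v y)
    rw [← inner_conj_symm, inner_orbitOperator, inner_orbitOperator, ← integral_conj]
    congr 1
    ext g
    rw [map_mul, inner_conj_symm, inner_conj_symm, mul_comm]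
  · rw [ContinuousLinearMap.reApplyInnerSelf_apply, ← inner_re_symm, inner_orbitOperator_self]
    exact integral_nonneg fun g => by positivity

/-- Compact operators form a closed convex set, which contains every average of its members against
a probability measure. -/
theorem isCompactOperator_orbitOperator [CompleteSpace V] (v : V) : IsCompactOperator (π.orbitOperator μ v) := by
  refine Convex.integral_mem (s := {T : V →L[ℂ] V | IsCompactOperator T})
    ((compactOperator (RingHom.id ℂ) V V).restrictScalars ℝ).convex
    isClosed_setOfPred_isCompactOperator ?_
    (π.continuous_rankOne_apply v).integrable_of_compactSpace
  exact Filter.Eventually.of_forall fun g => isCompactOperator_rankOne _ _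

theorem orbitOperator_comm [CompleteSpace V] [IsTopologicalGroup G] [μ.IsMulLeftInvariant] (v x : V) (h : G) :
    π.orbitOperator μ v (π.toHom h x) = π.toHom h (π.orbitOperator μ v x) := by
  refine ext_inner_left ℂ fun y => ?_
  -- Move `h` to the left slot as `h⁻¹`, then substitute `g ↦ h * g` by invariance of `μ`.
  rw [← inv_inv h, ← π.inner_apply_left, inner_orbitOperator, inner_orbitOperator,
    ← integral_mul_left_eq_self _ h⁻¹⁻¹]
  congr 1
  ext g
  rw [inv_inv, toHom_mul_apply, LinearIsometryEquiv.inner_map_map, π.inner_apply_left h⁻¹,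
    inv_inv]

/-- The trace bound: an eigenvalue of the orbit operator, counted with multiplicity, is at most
`‖v‖ ^ 2`. -/
theorem finrank_mul_le_of_orbitOperator_eq_smul [CompleteSpace V] (v : V) {c : ℝ} {W : Submodule ℂ V}
    [FiniteDimensional ℂ W] (hW : ∀ w ∈ W, π.orbitOperator μ v w = (c : ℂ) • w) :
    Module.finrank ℂ W * c ≤ ‖v‖ ^ 2 := by
  let b := stdOrthonormalBasis ℂ W
  have hb : Orthonormal ℂ fun i => (b i : V) := b.orthonormal.comp_linearIsometry W.subtypeₗᵢ
  have hint (i) : Integrable (fun g => ‖inner ℂ (b i : V) (π.toHom g v)‖ ^ 2) μ :=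
    ((continuous_const.inner (π.continuous_apply v)).norm.pow 2).integrable_of_compactSpace
  have hc (i) : ∫ g, ‖inner ℂ (b i : V) (π.toHom g v)‖ ^ 2 ∂μ = c := by
    have h := π.inner_orbitOperator_self μ v (b i)
    rw [hW _ (b i).2, inner_smul_right, inner_self_eq_norm_sq_to_K, hb.1 i] at h
    simpa using h.symm
  calc Module.finrank ℂ W * c
      = ∑ i, ∫ g, ‖inner ℂ (b i : V) (π.toHom g v)‖ ^ 2 ∂μ := by simp [hc]
    _ = ∫ g, ∑ i, ‖inner ℂ (b i : V) (π.toHom g v)‖ ^ 2 ∂μ :=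
      (integral_finsetSum _ fun i _ => hint i).symm
    _ ≤ ∫ _, ‖v‖ ^ 2 ∂μ := by
      refine integral_mono (integrable_finsetSum _ fun i _ => hint i) (integrable_const _)
        fun g => ?_
      -- Bessel's inequality, with `‖π g v‖ = ‖v‖`.
      simpa using hb.sum_inner_products_le (π.toHom g v) (s := Finset.univ)
    _ = ‖v‖ ^ 2 := by simp

/-- Fixed vectors are killed by the orbit operator of a vector orthogonal to them. -/
theorem orbitOperator_eq_zero_of_mem_fixed {v w : V} (hv : v ∈ π.fixedᗮ) (hw : w ∈ π.fixed) :
    π.orbitOperator μ v w = 0 := by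
  have h (g : G) : inner ℂ (π.toHom g v) w = 0 := by
    rw [← inner_conj_symm, π.inner_apply_right_of_mem_fixed hw, hv w hw, map_zero]
  simp [orbitOperator_apply, h]

theorem norm_orbitOperator_le [CompleteSpace V] [IsTopologicalGroup G] [μ.IsMulLeftInvariant] {D : ℝ} (hD : 0 < D)
    (hG : IsQuasiRandom G D) {v : V} (hv : v ∈ π.fixedᗮ) :
    ‖π.orbitOperator μ v‖ ≤ D⁻¹ * ‖v‖ ^ 2 := by
  set T := π.orbitOperator μ v with hTdef
  by_cases h0 : T = 0
  · rw [h0, norm_zero]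
    positivity
  have hT : IsCompactOperator T := π.isCompactOperator_orbitOperator μ v
  have hc : (‖T‖ : ℂ) ≠ 0 := by simpa using h0
  have heig := hT.hasEigenvalue_norm_of_isPositive (π.isPositive_orbitOperator μ v) h0
  set W := Module.End.eigenspace (T : Module.End ℂ V) (‖T‖ : ℂ)
  have hW (w : V) (hw : w ∈ W) : T w = (‖T‖ : ℂ) • w := Module.End.mem_eigenspace_iff.1 hw
  have : FiniteDimensional ℂ W := ContinuousLinearMap.finite_dimensional_eigenspace hT _ hc
  have hinv (g : G) (w : V) (hw : w ∈ W) : π.toHom g w ∈ W := by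
    refine Module.End.mem_eigenspace_iff.2 ?_
    change T (π.toHom g w) = _
    rw [hTdef, orbitOperator_comm, ← hTdef, hW w hw, map_smul]
  -- Otherwise `W` would be fixed, and `T` would both kill an eigenvector and scale it by `‖T‖ ≠ 0`.
  have hdim : D ≤ Module.finrank ℂ W := by
    by_contra! hlt
    obtain ⟨w, hw, hw0⟩ := heig.exists_hasEigenvector
    have hz := π.orbitOperator_eq_zero_of_mem_fixed μ hv
      (π.le_fixed_of_finrank_lt hG hinv hlt hw)
    rw [← hTdef, hW w hw] at hz
    exact (smul_ne_zero hc hw0) hz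
  rw [inv_mul_eq_div, le_div_iff₀' hD]
  exact (mul_le_mul_of_nonneg_right hdim (norm_nonneg T)).trans
    (π.finrank_mul_le_of_orbitOperator_eq_smul μ v hW)

theorem integral_norm_inner_sq_le_norm_orbitOperator [CompleteSpace V] (u v : V) :
    ∫ g, ‖inner ℂ u (π.toHom g v)‖ ^ 2 ∂μ ≤ ‖π.orbitOperator μ v‖ * ‖u‖ ^ 2 := by
  calc ∫ g, ‖inner ℂ u (π.toHom g v)‖ ^ 2 ∂μ
      ≤ ‖inner ℂ u (π.orbitOperator μ v u)‖ := by
        rw [inner_orbitOperator_self, Complex.norm_real]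
        exact le_abs_self _
    _ ≤ ‖u‖ * (‖π.orbitOperator μ v‖ * ‖u‖) :=
        (norm_inner_le_norm _ _).trans (by gcongr; exact ContinuousLinearMap.le_opNorm _ _)
    _ = _ := by ring

theorem integral_norm_inner_sq_le (u v : V) :
    ∫ g, ‖inner ℂ u (π.toHom g v)‖ ^ 2 ∂μ ≤ ‖u‖ ^ 2 * ‖v‖ ^ 2 := by
  calc ∫ g, ‖inner ℂ u (π.toHom g v)‖ ^ 2 ∂μ ≤ ∫ _, ‖u‖ ^ 2 * ‖v‖ ^ 2 ∂μ := by
        refine integral_mono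
          ((continuous_const.inner (π.continuous_apply v)).norm.pow 2).integrable_of_compactSpace
          (integrable_const _) fun g => ?_
        rw [← mul_pow]
        exact pow_le_pow_left₀ (norm_nonneg _)
          ((norm_inner_le_norm _ _).trans_eq (by rw [LinearIsometryEquiv.norm_map])) 2
    _ = _ := by simp

end Average

section Projection

variable {G : Type*} [Group G] [TopologicalSpace G] {V : Type*} [NormedAddCommGroup V]
  [InnerProductSpace ℂ V] [CompleteSpace V] (π : UnitaryRep G V)

theorem sub_proj_mem (v : V) : v - π.proj v ∈ π.fixedᗮ :=
  π.fixed.sub_starProjection_mem_orthogonal v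

theorem proj_mem (v : V) : π.proj v ∈ π.fixed :=
  π.fixed.starProjection_apply_mem v

theorem norm_sub_proj_le (v : V) : ‖v - π.proj v‖ ≤ ‖v‖ := by
  have h : v - π.proj v = π.fixedᗮ.starProjection v := by
    rw [Submodule.starProjection_orthogonal_val]
    rfl
  rw [h]
  exact π.fixedᗮ.norm_starProjection_apply_le v

/-- The cross terms vanish because `G` preserves both `π.fixed` and its orthogonal complement. -/
theorem inner_sub_inner_proj (g : G) (u v : V) :
    inner ℂ u (π.toHom g v) - inner ℂ (π.proj u) (π.proj v) =
      inner ℂ (u - π.proj u) (π.toHom g (v - π.proj v)) := by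
  have h1 : inner ℂ (π.proj u) (π.toHom g v) = inner ℂ (π.proj u) (π.proj v) := by
    rw [π.inner_apply_right_of_mem_fixed (π.proj_mem u), ← sub_eq_zero, ← inner_sub_right]
    exact π.sub_proj_mem v _ (π.proj_mem u)
  have h2 : inner ℂ (u - π.proj u) (π.proj v) = 0 :=
    Submodule.inner_left_of_mem_orthogonal (π.proj_mem v) (π.sub_proj_mem u)
  rw [map_sub, π.mem_fixed.1 (π.proj_mem v) g, inner_sub_right, h2, inner_sub_left, h1, sub_zero]

end Projection

end UnitaryRep

theorem corollary3 {G : Type*} [Group G] [TopologicalSpace G] [IsTopologicalGroup G]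
    [CompactSpace G] [T2Space G] [MeasurableSpace G] [BorelSpace G]
    (μ : Measure G) [μ.IsHaarMeasure] [IsProbabilityMeasure μ]
    {D : ℝ} (hD : 0 < D) (hG : IsQuasiRandom G D)
    {V : Type*} [NormedAddCommGroup V] [InnerProductSpace ℂ V] [CompleteSpace V]
    (π : UnitaryRep G V) (u v : V) :
    Integrable
        (fun g : G => ‖inner ℂ u (π.toHom g v) - inner ℂ (π.proj u) (π.proj v)‖ ^ 2) μ ∧
      ∫ g, ‖inner ℂ u (π.toHom g v) - inner ℂ (π.proj u) (π.proj v)‖ ^ 2 ∂μ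
        ≤ D ^ (-(1 / 2) : ℝ) * ‖u‖ ^ 2 * ‖v‖ ^ 2 ∧
      ∫ g, ‖inner ℂ u (π.toHom g v) - inner ℂ (π.proj u) (π.proj v)‖ ^ 2 ∂μ
        ≤ D⁻¹ * ‖u‖ ^ 2 * ‖v‖ ^ 2 := by
  simp only [π.inner_sub_inner_proj]
  set u' := u - π.proj u
  set v' := v - π.proj v
  have hu : ‖u'‖ ≤ ‖u‖ := π.norm_sub_proj_le u
  have hv : ‖v'‖ ≤ ‖v‖ := π.norm_sub_proj_le v
  have hmain : ∫ g, ‖inner ℂ u' (π.toHom g v')‖ ^ 2 ∂μ ≤ D⁻¹ * ‖u‖ ^ 2 * ‖v‖ ^ 2 :=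
    calc ∫ g, ‖inner ℂ u' (π.toHom g v')‖ ^ 2 ∂μ
        ≤ ‖π.orbitOperator μ v'‖ * ‖u'‖ ^ 2 :=
          π.integral_norm_inner_sq_le_norm_orbitOperator μ u' v'
      _ ≤ D⁻¹ * ‖v'‖ ^ 2 * ‖u'‖ ^ 2 := by
          gcongr
          exact π.norm_orbitOperator_le μ hD hG (π.sub_proj_mem v)
      _ ≤ D⁻¹ * ‖v‖ ^ 2 * ‖u‖ ^ 2 := by gcongr
      _ = _ := by ring
  refine ⟨((continuous_const.inner (π.continuous_apply v')).norm.pow 2).integrable_of_compactSpace,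
    ?_, hmain⟩
  -- For `D ≥ 1` the weaker bound follows from `D⁻¹`; for `D ≤ 1` Cauchy–Schwarz suffices, since `D
  -- ^ (-1/2) ≥ 1`.
  rcases le_total 1 D with h1 | h1
  · refine hmain.trans ?_
    gcongr
    rw [← Real.rpow_neg_one]
    exact Real.rpow_le_rpow_of_exponent_le h1 (by norm_num)
  · calc ∫ g, ‖inner ℂ u' (π.toHom g v')‖ ^ 2 ∂μ ≤ ‖u'‖ ^ 2 * ‖v'‖ ^ 2 :=
          π.integral_norm_inner_sq_le μ u' v'
      _ ≤ 1 * ‖u‖ ^ 2 * ‖v‖ ^ 2 := by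
          rw [one_mul]
          gcongr
      _ ≤ _ := by
          gcongr
          exact Real.one_le_rpow_of_pos_of_le_one_of_nonpos hD h1 (by norm_num)
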